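/- Let $d$ be a natural number and let $X_d$ denote either the space $C(\mathbb{R}^d)$ of continuous real-valued functions on $\mathbb{R}^d$ or the space $\mathcal{D}(\mathbb{R}^d)'$ of real-valued Schwartz distributions on $\mathbb{R}^d$. For $h\in\mathbb{R}^d$ and $P\in \mathrm{GL}(d,\mathbb{R})$ define operators $\tau_h, O_P: X_d\to X_d$ by $$\tau_h(g)(x)=g(x+h),\qquad O_P(g)(x)=g(Px)\qquad (g\in C(\mathbb{R}^d)),$$ and, for $f\in\mathcal{D}(\mathbb{R}^d)'$ and every test function $\phi$ (smooth, real-valued, compactly supported), by $$\tau_h(f)\{\phi\}=f\{\phi(\,\cdot-h)\},\qquad O_P(f)\{\phi\}=\frac{1}{|\det P|}\,f\{\phi(P^{-1}\,\cdot\,)\}.$$ **Theorem.** Let $G$ be a subgroup of $\mathrm{GL}(d,\mathbb{R})$ and let $V$ be a finite-dimensional vector subspace of $X_d$ (over $\mathbb{R}$). Suppose that for some $z_0\in\mathbb{R}^d$ the Minkowski difference $$Gz_0-Gz_0=\{Pz_0-Qz_0 : P,Q\in G\}\subseteq\mathbb{R}^d$$ has nonempty interior, that $\tau_h(V)\subseteq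 V$ for all $h\in\mathbb{R}^d$, and that $O_P(V)\subseteq V$ for all $P\in G$. Then every element $f$ of $V$ is an ordinary polynomial in $d$ real variables: there is $p\in\mathbb{R}[x_1,\dots,x_d]$ such that $f(x)=p(x)$ for all $x\in\mathbb{R}^d$ if $X_d=C(\mathbb{R}^d)$, and $f\{\phi\}=\int_{\mathbb{R}^d}p(x)\phi(x)\,dx$ for all test functions $\phi$ if $X_d=\mathcal{D}(\mathbb{R}^d)'$. -/

import Mathlib

open scoped Distributions

namespace InvariantPolynomials

/-- The space `ℝ^d`. All notions below (continuity, smoothness, compact supports, interiors, Lebesgue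
measure) do not depend on the choice of a norm on it. -/
abbrev Rd (d : ℕ) : Type := Fin d → ℝ

/-- The test functions on `ℝ^d`: smooth real-valued functions with compact support. -/
abbrev TestFn (d : ℕ) : Type := 𝓓((⊤ : TopologicalSpace.Opens (Rd d)), ℝ)

/-- The real-valued Schwartz distributions on `ℝ^d`: continuous linear forms on `TestFn d`. -/
abbrev Distr (d : ℕ) : Type := 𝓓'((⊤ : TopologicalSpace.Opens (Rd d)), ℝ)

/-! ### Minkowski difference of an orbit with itself -/

/-- The set `G z₀ - G z₀ = {P z₀ - Q z₀ : P, Q ∈ G}`. -/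
def orbitDifference {d : ℕ} (G : Subgroup (Matrix.GeneralLinearGroup (Fin d) ℝ)) (z₀ : Rd d) :
    Set (Rd d) :=
  {w | ∃ P ∈ G, ∃ Q ∈ G, w = P.1.mulVec z₀ - Q.1.mulVec z₀}

/-! ### The operators on continuous functions -/

/-- The translation `(τ_h g)(x) = g (x + h)` of a continuous function. -/
def translateFun {d : ℕ} (h : Rd d) : C(Rd d, ℝ) →ₗ[ℝ] C(Rd d, ℝ) where
  toFun g := ⟨fun x => g (x + h), by fun_prop⟩
  map_add' _ _ := rfl
  map_smul' _ _ := rfl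

/-- The linear substitution `(O_P g)(x) = g (P x)` in a continuous function. -/
def substFun {d : ℕ} (P : Matrix.GeneralLinearGroup (Fin d) ℝ) :
    C(Rd d, ℝ) →ₗ[ℝ] C(Rd d, ℝ) where
  toFun g := ⟨fun x => g (P.1.mulVec x), g.continuous.comp (by fun_prop)⟩
  map_add' _ _ := rfl
  map_smul' _ _ := rfl

/-! ### The operators on test functions -/

/-- An invertible matrix, as a linear homeomorphism of `ℝ^d`. -/
noncomputable def toCLE {d : ℕ} (P : Matrix.GeneralLinearGroup (Fin d) ℝ) : Rd d ≃L[ℝ] Rd d :=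
  (Matrix.toLin'OfInv P.inv_val P.val_inv).toContinuousLinearEquiv

theorem toCLE_apply {d : ℕ} (P : Matrix.GeneralLinearGroup (Fin d) ℝ) (x : Rd d) :
    toCLE P x = P.1.mulVec x :=
  Matrix.toLin'_apply P.1 x

/-- The map `x ↦ A x + h` as a homeomorphism. -/
noncomputable def affineHomeo {d : ℕ} (A : Rd d ≃L[ℝ] Rd d) (h : Rd d) : Rd d ≃ₜ Rd d :=
  A.toHomeomorph.trans (Homeomorph.addRight h)

theorem affineHomeo_apply {d : ℕ} (A : Rd d ≃L[ℝ] Rd d) (h x : Rd d) :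
    affineHomeo A h x = A x + h := rfl

theorem contDiff_comp_affine {d : ℕ} (A : Rd d ≃L[ℝ] Rd d) (h : Rd d) {n : WithTop ℕ∞}
    {f : Rd d → ℝ} (hf : ContDiff ℝ n f) : ContDiff ℝ n (fun x => f (A x + h)) :=
  hf.comp (A.contDiff.add contDiff_const)

theorem norm_iteratedFDeriv_comp_affine_le {d : ℕ} (A : Rd d ≃L[ℝ] Rd d) (h : Rd d)
    {f : Rd d → ℝ} {i : ℕ} (hf : ContDiff ℝ i f) (x : Rd d) :
    ‖iteratedFDeriv ℝ i (fun x => f (A x + h)) x‖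
      ≤ ‖(A : Rd d →L[ℝ] Rd d)‖ ^ i * ‖iteratedFDeriv ℝ i f (A x + h)‖ := by
  have h1 : ContDiff ℝ i (fun y => f (y + h)) := hf.comp (contDiff_id.add contDiff_const)
  have h2 := (A : Rd d →L[ℝ] Rd d).iteratedFDeriv_comp_right h1 x le_rfl
  have h3 : (fun x => f (A x + h)) = (fun y => f (y + h)) ∘ (A : Rd d →L[ℝ] Rd d) := rfl
  rw [h3, h2, iteratedFDeriv_comp_add_right]
  refine (ContinuousMultilinearMap.norm_compContinuousLinearMap_le _ _).trans ?_
  simp [mul_comm]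

/-- The preimage of a compact set under `x ↦ A x + h`. -/
noncomputable def affinePreimage {d : ℕ} (A : Rd d ≃L[ℝ] Rd d) (h : Rd d)
    (K : TopologicalSpace.Compacts (Rd d)) : TopologicalSpace.Compacts (Rd d) :=
  ⟨affineHomeo A h ⁻¹' K, (affineHomeo A h).isCompact_preimage.2 K.isCompact⟩

/-- Composition with `x ↦ A x + h`, on the test functions that vanish outside of `K`. -/
noncomputable def compAffineSupportedIn {d : ℕ} (A : Rd d ≃L[ℝ] Rd d) (h : Rd d)
    (K : TopologicalSpace.Compacts (Rd d)) :
    𝓓_{K}(Rd d, ℝ) →L[ℝ] 𝓓_{affinePreimage A h K}(Rd d, ℝ) :=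
  ContDiffMapSupportedIn.mkCLM ℝ (fun φ x => φ (A x + h))
    (fun _ _ _ => rfl) (fun _ _ _ => rfl)
    (fun φ => contDiff_comp_affine A h φ.contDiff)
    (fun φ _ hx => φ.zero_on_compl hx)
    (fun i _ => ⟨{i}, ‖(A : Rd d →L[ℝ] Rd d)‖ ^ i, by positivity, fun φ x _ => by
      refine (norm_iteratedFDeriv_comp_affine_le A h
        (φ.contDiff.of_le (by exact_mod_cast le_top)) x).trans ?_
      rw [Finset.sup_singleton]
      gcongr
      exact ContDiffMapSupportedIn.norm_iteratedFDeriv_apply_le_seminorm_top ℝ⟩)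

/-- Composition of test functions with `x ↦ A x + h`, as a continuous linear operator. -/
noncomputable def compAffine {d : ℕ} (A : Rd d ≃L[ℝ] Rd d) (h : Rd d) :
    TestFn d →L[ℝ] TestFn d :=
  TestFunction.limitCLM ℝ
    (fun φ => ⟨fun x => φ (A x + h), contDiff_comp_affine A h φ.contDiff,
      φ.hasCompactSupport.comp_homeomorph (affineHomeo A h), fun _ _ => trivial⟩)
    (fun K _ => TestFunction.ofSupportedInCLM ℝ (fun _ _ => trivial) ∘L
      compAffineSupportedIn A h K)
    (fun _ _ _ => rfl)

/-- The translation `(τ_h φ)(x) = φ (x + h)` of a test function. -/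
noncomputable def translateTest {d : ℕ} (h : Rd d) : TestFn d →L[ℝ] TestFn d :=
  compAffine (ContinuousLinearEquiv.refl ℝ (Rd d)) h

theorem translateTest_apply {d : ℕ} (h : Rd d) (φ : TestFn d) (x : Rd d) :
    translateTest h φ x = φ (x + h) := rfl

/-- The linear substitution `(O_P φ)(x) = φ (P x)` in a test function. -/
noncomputable def substTest {d : ℕ} (P : Matrix.GeneralLinearGroup (Fin d) ℝ) :
    TestFn d →L[ℝ] TestFn d :=
  compAffine (toCLE P) 0

theorem substTest_apply {d : ℕ} (P : Matrix.GeneralLinearGroup (Fin d) ℝ) (φ : TestFn d)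
    (x : Rd d) : substTest P φ x = φ (P.1.mulVec x) := by
  change φ (toCLE P x + 0) = _
  rw [add_zero, toCLE_apply]

/-! ### The operators on distributions -/

/-- The translation of a distribution: `(τ_h f){φ} = f{τ_{-h} φ}`. -/
noncomputable def translateDistr {d : ℕ} (h : Rd d) : Distr d →L[ℝ] Distr d :=
  (translateTest (-h)).precompCompactConvergenceCLM ℝ

theorem translateDistr_apply {d : ℕ} (h : Rd d) (f : Distr d) (φ : TestFn d) :
    translateDistr h f φ = f (translateTest (-h) φ) := rfl

/-- The linear substitution in a distribution: `(O_P f){φ} = |det P|⁻¹ f{O_{P⁻¹} φ}`. -/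
noncomputable def substDistr {d : ℕ} (P : Matrix.GeneralLinearGroup (Fin d) ℝ) :
    Distr d →L[ℝ] Distr d :=
  |P.1.det|⁻¹ • (substTest P⁻¹).precompCompactConvergenceCLM ℝ

theorem substDistr_apply {d : ℕ} (P : Matrix.GeneralLinearGroup (Fin d) ℝ) (f : Distr d)
    (φ : TestFn d) : substDistr P f φ = |P.1.det|⁻¹ * f (substTest P⁻¹ φ) := rfl

/-! ### Ordinary polynomials -/

/-- A continuous function on `ℝ^d` is an ordinary polynomial in `d` real variables. -/
def IsPolynomialFun {d : ℕ} (f : C(Rd d, ℝ)) : Prop :=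
  ∃ p : MvPolynomial (Fin d) ℝ, ∀ x : Rd d, f x = MvPolynomial.eval x p

/-- A distribution on `ℝ^d` is (integration against Lebesgue measure of) an ordinary polynomial in
`d` real variables. The integrand is continuous with compact support, hence integrable. -/
def IsPolynomialDistr {d : ℕ} (f : Distr d) : Prop :=
  ∃ p : MvPolynomial (Fin d) ℝ, ∀ φ : TestFn d, f φ = ∫ x : Rd d, MvPolynomial.eval x p * φ x

end InvariantPolynomials

/-!
Write `τ_h` for the translations and `V` for the invariant space. Three facts give the result.

*The translations of `V` are unipotent.* The relation `τ_h O_P = O_P τ_{P h}` makes `τ_{P z₀}`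
conjugate to `τ_{z₀}` on `V` for every `P ∈ G`, so the complex eigenvalues of the operators
`τ_{P z₀}` lie in one finite set. Eigenvalues of a product of commuting operators are products of
eigenvalues, hence the eigenvalues of `τ_h` stay in a finite set for `h` in `G z₀ - G z₀`, and then
for `h` in a neighbourhood of `0`, namely the set of differences of interior points. An eigenvalue
of `τ_x` is the `n`-th power of an eigenvalue of `τ_{x/n}` whose first powers remain in that finite
set; the pigeonhole principle shows that it is `1` (`spectrum_subset_one_of_finite`,
`isNilpotent_sub_one`).

*A unipotent representation of `ℝ^d` with continuous coefficients has polynomial coefficients.*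
On a line, the binomial formula for `A ^ k = (1 + (A - 1)) ^ k` gives a polynomial on each lattice
`(1/m) ℕ`; these polynomials agree on `ℕ`, hence are equal, and continuity gives the whole line.
Products over the coordinate axes give `ℝ^d` (`exists_mvPolynomial_of_unipotent`). For continuous
functions this is enough, as `f(x) = (τ_x f)(0)`.

*A distribution with polynomial translates is a polynomial.* A distribution commutes with
convolutions: `f(ψ ⋆ φ) = ∫ ψ(t) f(τ_{-t} φ) dt` (`apply_convTest`). This holds because on the test
functions with a fixed compact support `f` factors through a Banach space of finitely many
derivatives, in which the convolution is a Bochner integral. If `f(τ_{-t} φ) = ∑ c_j(φ) p_j(t)`,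
comparing `ψ ⋆ φ` with `φ ⋆ ψ` shows that `f` vanishes on the common kernel of the finitely many
forms `φ ↦ ∫ p_j φ`, so that `f` is a combination of them (`isPolynomialDistr_of_translate_eq`).
-/

namespace InvariantPolynomials

/-! ### Commuting operators with few eigenvalues -/

theorem exists_eigenvector_mem {K W : Type*} [Field K] [IsAlgClosed K] [AddCommGroup W] [Module K W]
    [FiniteDimensional K W] {f : Module.End K W} {p : Submodule K W} (hp : p ≠ ⊥)
    (hf : ∀ x ∈ p, f x ∈ p) : ∃ a : K, ∃ v ∈ p, v ≠ 0 ∧ f v = a • v := by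
  have : Nontrivial p := Submodule.nontrivial_iff_ne_bot.2 hp
  obtain ⟨a, ha⟩ := Module.End.exists_eigenvalue (f.restrict hf)
  obtain ⟨v, hv⟩ := ha.exists_hasEigenvector
  refine ⟨a, v, v.2, fun h => hv.2 (Subtype.ext h), ?_⟩
  exact congrArg Subtype.val hv.apply_eq_smul

theorem mem_spectrum_of_apply_eq_smul {K W : Type*} [Field K] [AddCommGroup W] [Module K W]
    [FiniteDimensional K W] {f : Module.End K W} {a : K} {v : W} (hv : v ≠ 0) (h : f v = a • v) :
    a ∈ spectrum K f :=
  Module.End.hasEigenvalue_iff_mem_spectrum.1 (Module.End.hasEigenvalue_of_hasEigenvector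
    ⟨Module.End.mem_eigenspace_iff.2 h, hv⟩)

open scoped Pointwise in
theorem spectrum_mul_subset {K W : Type*} [Field K] [IsAlgClosed K] [AddCommGroup W] [Module K W]
    [FiniteDimensional K W] {f g : Module.End K W} (hfg : Commute f g) :
    spectrum K (f * g) ⊆ spectrum K f * spectrum K g := by
  intro c hc
  have hc' := Module.End.hasEigenvalue_iff_mem_spectrum.2 hc
  have hcomm : ∀ x, f (g x) = g (f x) := fun x => LinearMap.congr_fun hfg x
  obtain ⟨a, v, hvc, hv0, hva⟩ := exists_eigenvector_mem (f := f) hc' fun x hx => by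
    rw [Module.End.mem_genEigenspace_one] at hx ⊢
    rw [Module.End.mul_apply] at hx ⊢
    rw [← hcomm, hx, map_smul]
  have hp : (f * g).eigenspace c ⊓ f.eigenspace a ≠ ⊥ := fun h =>
    hv0 ((Submodule.mem_bot K).1 (h ▸ ⟨hvc, Module.End.mem_eigenspace_iff.2 hva⟩))
  obtain ⟨b, w, ⟨hwc, hwa⟩, hw0, hwb⟩ := exists_eigenvector_mem (f := g) hp fun x hx => by
    rw [Submodule.mem_inf, Module.End.mem_eigenspace_iff, Module.End.mem_eigenspace_iff,
      Module.End.mul_apply] at hx ⊢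
    constructor
    · rw [hcomm, hx.1, map_smul]
    · rw [hcomm, hx.2, map_smul]
  refine ⟨a, mem_spectrum_of_apply_eq_smul hw0 (Module.End.mem_eigenspace_iff.1 hwa), b,
    mem_spectrum_of_apply_eq_smul hw0 hwb, ?_⟩
  have h1 := Module.End.mem_eigenspace_iff.1 hwc
  rw [Module.End.mul_apply, hwb, map_smul, Module.End.mem_eigenspace_iff.1 hwa, smul_smul] at h1
  change a * b = c
  exact mul_comm a b ▸ smul_left_injective K hw0 h1

/-- Pigeonhole principle: if `c ^ 0, …, c ^ m` lie in a set of `m` elements, then `c` is a root of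
unity of order at most `m`, so that `c ^ n = 1` as soon as `m!` divides `n`. -/
theorem pow_eq_one_of_pow_mem {K : Type*} [Field K] {c : K} (hc : c ≠ 0) {F : Finset K}
    (hF : ∀ j ≤ F.card, c ^ j ∈ F) {n : ℕ} (hn : F.card.factorial ∣ n) : c ^ n = 1 := by
  obtain ⟨i, hi, j, hj, hij, h⟩ := Finset.exists_ne_map_eq_of_card_lt_of_maps_to
    (s := Finset.range (F.card + 1)) (t := F) (f := fun j => c ^ j) (by simp)
    (fun j hj => hF j (by simpa [Nat.lt_succ_iff] using hj))
  wlog hlt : i < j generalizing i j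
  · exact this j hj i hi hij.symm h.symm (by omega)
  have h1 : c ^ (j - i) = 1 := by
    have : c ^ i * c ^ (j - i) = c ^ i * 1 := by
      rw [← pow_add, Nat.add_sub_cancel' hlt.le, mul_one]; exact h.symm
    exact mul_left_cancel₀ (pow_ne_zero _ hc) this
  have h2 : j - i ∣ n := (Nat.dvd_factorial (by omega) (by
    have := Finset.mem_range.1 hj; omega)).trans hn
  obtain ⟨k, rfl⟩ := h2
  rw [pow_mul, h1, one_pow]

open scoped Pointwise in
/-- If the spectra of a representation of a vector group stay in a finite set over a set `S` such
that `S - S` has nonempty interior, then all of them are trivial. No continuity is needed. -/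
theorem spectrum_subset_one_of_finite {K W E : Type*} [Field K] [IsAlgClosed K] [AddCommGroup W]
    [Module K W] [FiniteDimensional K W] [NormedAddCommGroup E] [NormedSpace ℝ E]
    (σ : Multiplicative E →* Module.End K W) {S : Set E} {T : Set K} (hT : T.Finite)
    (hS : ∀ a ∈ S, spectrum K (σ (.ofAdd a)) ⊆ T)
    (hU : (interior (S - S)).Nonempty) (x : E) :
    spectrum K (σ (.ofAdd x)) ⊆ {1} := by
  have hcomm : ∀ a b, Commute (σ a) (σ b) := fun a b => (Commute.all a b).map σ
  have hinv : ∀ a : E, spectrum K (σ (.ofAdd (-a))) = (spectrum K (σ (.ofAdd a)))⁻¹ := by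
    intro a
    rw [ofAdd_neg]
    exact (spectrum.map_inv (Units.map σ (toUnits (Multiplicative.ofAdd a)))).symm
  have hsub : ∀ (A : Set E) (B : Set K), (∀ a ∈ A, spectrum K (σ (.ofAdd a)) ⊆ B) →
      ∀ a ∈ A - A, spectrum K (σ (.ofAdd a)) ⊆ B * B⁻¹ := by
    rintro A B h _ ⟨a, ha, b, hb, rfl⟩
    change spectrum K (σ (.ofAdd (a - b))) ⊆ _
    rw [sub_eq_add_neg, ofAdd_add, map_mul]
    refine (spectrum_mul_subset (hcomm _ _)).trans (Set.mul_subset_mul (h a ha) ?_)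
    rw [hinv]
    exact Set.inv_subset_inv.2 (h b hb)
  -- The spectra over a neighbourhood of `0` lie in a fixed finite set.
  set B := (T * T⁻¹) * (T * T⁻¹)⁻¹ with hB
  have hBfin : B.Finite := by
    have h := hT.mul hT.inv
    exact h.mul h.inv
  have hball : ∃ ε > 0, ∀ y : E, ‖y‖ < ε → spectrum K (σ (.ofAdd y)) ⊆ B := by
    have h0 : interior (S - S) - interior (S - S) ∈ nhds (0 : E) := by
      obtain ⟨u, hu⟩ := hU
      exact (isOpen_interior.sub_left).mem_nhds ⟨u, hu, u, hu, sub_self u⟩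
    obtain ⟨ε, hε, h⟩ := Metric.mem_nhds_iff.1 h0
    refine ⟨ε, hε, fun y hy => hsub (S - S) _ (hsub S T hS) y ?_⟩
    exact Set.sub_subset_sub interior_subset interior_subset (h (by simpa using hy))
  obtain ⟨ε, hε, hball⟩ := hball
  set F := hBfin.toFinset with hF
  obtain ⟨N, hN⟩ := exists_nat_gt (‖x‖ / ε)
  have hN0 : 0 < (N : ℝ) := lt_of_le_of_lt (by positivity) hN
  -- With `n = N * m!` and `y = x / n`, the points `j • y`, for `j ≤ m`, are within `ε` of `0`.
  set n : ℕ := N * F.card.factorial with hn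
  have hn0 : 0 < n := Nat.mul_pos (by exact_mod_cast hN0) (Nat.factorial_pos _)
  have hnr : (0 : ℝ) < n := by exact_mod_cast hn0
  set y : E := (n : ℝ)⁻¹ • x with hy
  have hpow : ∀ j : ℕ, σ (.ofAdd ((j : ℝ) • y)) = σ (.ofAdd y) ^ j := by
    intro j
    rw [Nat.cast_smul_eq_nsmul, ofAdd_nsmul, map_pow]
  have hxy : x = (n : ℝ) • y := by
    rw [hy, smul_smul, mul_inv_cancel₀ hnr.ne', one_smul]
  intro c hc
  rw [hxy, hpow, spectrum.map_pow_of_pos _ hn0] at hc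
  obtain ⟨b, hb, rfl⟩ := hc
  refine pow_eq_one_of_pow_mem (F := F) ?_ ?_ (Dvd.intro_left _ rfl)
  · rintro rfl
    exact spectrum.zero_notMem K ((Group.isUnit (Multiplicative.ofAdd y)).map σ) hb
  · intro j hj
    rw [hF, Set.Finite.mem_toFinset]
    refine hball ((j : ℝ) • y) ?_ ?_
    · have hj' : (j : ℝ) ≤ F.card.factorial := by
        exact_mod_cast hj.trans (Nat.self_le_factorial _)
      rw [hy, smul_smul, norm_smul, Real.norm_of_nonneg (by positivity)]
      rw [div_lt_iff₀ hε] at hN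
      calc (j : ℝ) * (n : ℝ)⁻¹ * ‖x‖ ≤ F.card.factorial * (n : ℝ)⁻¹ * ‖x‖ := by gcongr
        _ = ‖x‖ / N := by
          rw [hn, Nat.cast_mul]
          have : (F.card.factorial : ℝ) ≠ 0 := by positivity
          field_simp
        _ < ε := by rwa [div_lt_iff₀ hN0, mul_comm]
    · rw [hpow]
      exact spectrum.pow_image_subset _ _ ⟨b, hb, rfl⟩

theorem isNilpotent_sub_one_of_spectrum_subset {K W : Type*} [Field K] [IsAlgClosed K]
    [AddCommGroup W] [Module K W] [FiniteDimensional K W] {f : Module.End K W}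
    (hf : spectrum K f ⊆ {1}) : IsNilpotent (f - 1) := by
  have h : f.maxGenEigenspace 1 = ⊤ := by
    rw [eq_top_iff, ← Module.End.iSup_maxGenEigenspace_eq_top f, iSup_le_iff]
    intro c
    by_cases hc : c = 1
    · rw [hc]
    · have : ¬ f.HasEigenvalue c := fun h =>
        hc (hf (Module.End.hasEigenvalue_iff_mem_spectrum.1 h))
      have h2 : f.maxGenEigenspace c = ⊥ := by
        by_contra h2
        exact this (Module.End.HasUnifEigenvalue.lt zero_lt_one h2)
      rw [h2]
      exact bot_le
  refine ⟨Module.finrank K W, ?_⟩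
  rw [Module.End.maxGenEigenspace_eq_genEigenspace_finrank, Module.End.genEigenspace_nat,
    LinearMap.ker_eq_top, one_smul] at h
  exact h

theorem spectrum_baseChange {V : Type*} [AddCommGroup V] [Module ℝ V]
    [FiniteDimensional ℝ V] (f : Module.End ℝ V) :
    spectrum ℂ (Module.End.baseChangeHom ℝ ℂ V f) =
      {c | c ∈ (f.charpoly.map (algebraMap ℝ ℂ)).roots} := by
  ext c
  rw [← Module.End.hasEigenvalue_iff_mem_spectrum, Module.End.hasEigenvalue_iff_isRoot_charpoly]
  have h : (Module.End.baseChangeHom ℝ ℂ V f).charpoly = f.charpoly.map (algebraMap ℝ ℂ) :=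
    LinearMap.charpoly_baseChange _ _
  rw [h, Set.mem_ofPred_eq, Polynomial.mem_roots]
  rw [← h]
  exact (LinearMap.charpoly_monic _).ne_zero

open scoped Pointwise in
/-- If the operators of a real representation of a vector group have the same characteristic
polynomial over a set `S` such that `S - S` has nonempty interior, then the representation is
unipotent. -/
theorem isNilpotent_sub_one {V E : Type*} [AddCommGroup V] [Module ℝ V]
    [FiniteDimensional ℝ V] [NormedAddCommGroup E] [NormedSpace ℝ E]
    (ρ : Multiplicative E →* Module.End ℝ V) {S : Set E} {χ : Polynomial ℝ}
    (hS : ∀ a ∈ S, LinearMap.charpoly (ρ (.ofAdd a)) = χ)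
    (hU : (interior (S - S)).Nonempty) (x : E) :
    IsNilpotent (ρ (.ofAdd x) - 1) := by
  have hinj : Function.Injective (Module.End.baseChangeHom ℝ ℂ V) :=
    LinearMap.baseChangeHom_injective ℝ V ℂ
  refine (IsNilpotent.map_iff hinj).1 ?_
  rw [map_sub, map_one]
  refine isNilpotent_sub_one_of_spectrum_subset
    (spectrum_subset_one_of_finite
      ((Module.End.baseChangeHom ℝ ℂ V).toRingHom.toMonoidHom.comp ρ)
      (Multiset.finite_toSet (χ.map (algebraMap ℝ ℂ)).roots) (fun a ha => ?_) hU x)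
  rw [← hS a ha]
  exact (spectrum_baseChange _).subset

/-! ### Continuous unipotent representations of vector groups are polynomial -/

theorem exists_polynomial_of_isNilpotent_sub_one {V : Type*} [AddCommGroup V] [Module ℝ V]
    {A : Module.End ℝ V} (hA : IsNilpotent (A - 1)) (l : Module.Dual ℝ V) (v : V) :
    ∃ q : Polynomial ℝ, ∀ k : ℕ, l ((A ^ k) v) = q.eval (k : ℝ) := by
  obtain ⟨N, hN⟩ := hA
  refine ⟨∑ j ∈ Finset.range N, Polynomial.C (l (((A - 1) ^ j) v) * (j.factorial : ℝ)⁻¹) *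
    descPochhammer ℝ j, fun k => ?_⟩
  have h1 : A ^ k = ∑ j ∈ Finset.range (k + 1), (A - 1) ^ j * (k.choose j : Module.End ℝ V) := by
    have := (Commute.one_right (A - 1)).add_pow k
    simpa using this
  have h2 : A ^ k = ∑ j ∈ Finset.range N, (A - 1) ^ j * (k.choose j : Module.End ℝ V) := by
    rw [h1]
    rcases le_total (k + 1) N with h | h
    · refine Finset.sum_subset (Finset.range_mono h) fun j _ hj => ?_
      rw [Nat.choose_eq_zero_of_lt (by simpa using hj), Nat.cast_zero, mul_zero]
    · refine (Finset.sum_subset (Finset.range_mono h) fun j _ hj => ?_).symm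
      rw [pow_eq_zero_of_le (by simpa using hj) hN, zero_mul]
  rw [h2, LinearMap.sum_apply, map_sum, Polynomial.eval_finsetSum]
  refine Finset.sum_congr rfl fun j _ => ?_
  rw [Polynomial.eval_mul, Polynomial.eval_C, descPochhammer_eval_eq_descFactorial,
    Nat.descFactorial_eq_factorial_mul_choose, Nat.cast_mul, Module.End.mul_apply]
  have : (k.choose j : Module.End ℝ V) v = (k.choose j : ℝ) • v := by
    rw [Module.End.natCast_apply, Nat.cast_smul_eq_nsmul]
  rw [this, map_smul, map_smul, smul_eq_mul]
  have : (j.factorial : ℝ) ≠ 0 := by positivity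
  field_simp

theorem polynomial_eq_of_eval_nat_eq {p q : Polynomial ℝ}
    (h : ∀ k : ℕ, p.eval (k : ℝ) = q.eval (k : ℝ)) : p = q :=
  Polynomial.eq_of_infinite_eval_eq p q
    ((Set.infinite_range_of_injective Nat.cast_injective).mono (by rintro _ ⟨k, rfl⟩; exact h k))

/-- The polynomials obtained on the lattices `(1/m) ℕ` agree on `ℕ`, so they are the same one, and
continuity extends the equality from the nonnegative rationals. -/
theorem exists_polynomial_nonneg {V E : Type*} [AddCommGroup V] [Module ℝ V]
    [NormedAddCommGroup E] [NormedSpace ℝ E]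
    (ρ : Multiplicative E →* Module.End ℝ V) (hρ : ∀ x, IsNilpotent (ρ (.ofAdd x) - 1))
    (hc : ∀ (l : Module.Dual ℝ V) (v : V), Continuous fun x : E => l (ρ (.ofAdd x) v))
    (e : E) (l : Module.Dual ℝ V) (v : V) :
    ∃ q : Polynomial ℝ, ∀ t : ℝ, 0 ≤ t → l (ρ (.ofAdd (t • e)) v) = q.eval t := by
  have hn : ∀ (x : E) (k : ℕ), ρ (.ofAdd ((k : ℝ) • x)) = ρ (.ofAdd x) ^ k := fun x k => by
    rw [Nat.cast_smul_eq_nsmul, ofAdd_nsmul, map_pow]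
  obtain ⟨q, hq⟩ := exists_polynomial_of_isNilpotent_sub_one (hρ e) l v
  refine ⟨q, ?_⟩
  have hrat : ∀ k m : ℕ, 0 < m →
      l (ρ (.ofAdd (((k : ℝ) / m) • e)) v) = q.eval ((k : ℝ) / m) := by
    intro k m hm
    have hm' : (m : ℝ) ≠ 0 := by positivity
    obtain ⟨r, hr⟩ := exists_polynomial_of_isNilpotent_sub_one (hρ ((m : ℝ)⁻¹ • e)) l v
    have hqr : r.comp (Polynomial.C (m : ℝ) * Polynomial.X) = q := by
      refine polynomial_eq_of_eval_nat_eq fun j => ?_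
      rw [Polynomial.eval_comp, Polynomial.eval_mul, Polynomial.eval_C, Polynomial.eval_X,
        ← Nat.cast_mul, ← hr, ← hq, ← hn, ← hn, smul_smul, Nat.cast_mul]
      congr 5
      field_simp
    rw [← hqr, Polynomial.eval_comp, Polynomial.eval_mul, Polynomial.eval_C, Polynomial.eval_X,
      mul_div_cancel₀ _ hm', ← hr, ← hn, smul_smul, div_eq_mul_inv]
  intro t ht
  have hcont : Continuous fun s : ℝ => l (ρ (.ofAdd (s • e)) v) :=
    (hc l v).comp (by fun_prop : Continuous fun s : ℝ => s • e)
  have hlim : Filter.Tendsto (fun n : ℕ => (⌊t * n⌋₊ : ℝ) / n) Filter.atTop (nhds t) :=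
    (tendsto_nat_floor_mul_div_atTop ht).comp tendsto_natCast_atTop_atTop
  refine tendsto_nhds_unique_of_eventuallyEq ((hcont.tendsto t).comp hlim)
    ((q.continuous.tendsto t).comp hlim) ?_
  filter_upwards [Filter.eventually_gt_atTop 0] with n hn
  exact hrat _ _ hn

/-- The negative half-line is reached by applying `exists_polynomial_nonneg` to a translated
vector. -/
theorem exists_polynomial_line {V E : Type*} [AddCommGroup V] [Module ℝ V]
    [NormedAddCommGroup E] [NormedSpace ℝ E]
    (ρ : Multiplicative E →* Module.End ℝ V) (hρ : ∀ x, IsNilpotent (ρ (.ofAdd x) - 1))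
    (hc : ∀ (l : Module.Dual ℝ V) (v : V), Continuous fun x : E => l (ρ (.ofAdd x) v))
    (e : E) (l : Module.Dual ℝ V) (v : V) :
    ∃ q : Polynomial ℝ, ∀ t : ℝ, l (ρ (.ofAdd (t • e)) v) = q.eval t := by
  obtain ⟨q, hq⟩ := exists_polynomial_nonneg ρ hρ hc e l v
  refine ⟨q, fun t => ?_⟩
  obtain ⟨r, hr⟩ := exists_polynomial_nonneg ρ hρ hc e l (ρ (.ofAdd (-|t| • e)) v)
  have hr' : ∀ s : ℝ, -|t| ≤ s → l (ρ (.ofAdd (s • e)) v) = r.eval (s + |t|) := by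
    intro s hs
    rw [← hr _ (by linarith), ← Module.End.mul_apply, ← map_mul, ← ofAdd_add, ← add_smul,
      add_neg_cancel_right]
  have hqr : r.comp (Polynomial.X + Polynomial.C |t|) = q := by
    refine polynomial_eq_of_eval_nat_eq fun k => ?_
    rw [Polynomial.eval_comp, Polynomial.eval_add, Polynomial.eval_C, Polynomial.eval_X,
      ← hr' _ ((neg_nonpos.2 (abs_nonneg t)).trans k.cast_nonneg), hq _ k.cast_nonneg]
  rw [hr' t (neg_abs_le t), ← hqr, Polynomial.eval_comp, Polynomial.eval_add, Polynomial.eval_C,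
    Polynomial.eval_X]

theorem exists_mvPolynomial_of_unipotent {d : ℕ} {V : Type*} [AddCommGroup V] [Module ℝ V]
    [FiniteDimensional ℝ V]
    (ρ : Multiplicative (Rd d) →* Module.End ℝ V) (hρ : ∀ x, IsNilpotent (ρ (.ofAdd x) - 1))
    (hc : ∀ (l : Module.Dual ℝ V) (v : V), Continuous fun x : Rd d => l (ρ (.ofAdd x) v))
    (l : Module.Dual ℝ V) (v : V) :
    ∃ p : MvPolynomial (Fin d) ℝ, ∀ x : Rd d, l (ρ (.ofAdd x) v) = MvPolynomial.eval x p := by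
  have key : ∀ s : Finset (Fin d), ∀ l : Module.Dual ℝ V, ∃ p : MvPolynomial (Fin d) ℝ,
      ∀ x : Rd d, l (ρ (.ofAdd (∑ i ∈ s, x i • Pi.single i (1 : ℝ))) v) = MvPolynomial.eval x p := by
    intro s
    induction s using Finset.induction_on with
    | empty => exact fun l => ⟨MvPolynomial.C (l v), fun x => by simp⟩
    | insert i s hi ih =>
      intro l
      let b := Module.finBasis ℝ V
      choose p hp using fun j => ih (b.coord j)
      choose q hq using fun j => exists_polynomial_line ρ hρ hc (Pi.single i (1 : ℝ)) l (b j)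
      refine ⟨∑ j, p j * (q j).toMvPolynomial i, fun x => ?_⟩
      rw [Finset.sum_insert hi, ofAdd_add, map_mul, Module.End.mul_apply]
      set w := ρ (.ofAdd (∑ i ∈ s, x i • Pi.single i (1 : ℝ))) v with hw
      conv_lhs => rw [← b.sum_repr w]
      simp only [map_sum, map_smul, map_mul, smul_eq_mul]
      refine Finset.sum_congr rfl fun j _ => ?_
      rw [hq, ← hp, MvPolynomial.eval_toMvPolynomial]
      rfl
  obtain ⟨p, hp⟩ := key Finset.univ l
  refine ⟨p, fun x => ?_⟩
  rw [← hp x]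
  congr 4
  exact pi_eq_sum_univ' x

/-! ### Distributions and convolutions of test functions -/

theorem contDiff_iteratedFDeriv_apply {d : ℕ} {φ : Rd d → ℝ}
    (hφ : ContDiff ℝ ((⊤ : ℕ∞) : WithTop ℕ∞) φ) (i : ℕ) (m : Fin i → Rd d) :
    ContDiff ℝ 1 (fun x => iteratedFDeriv ℝ i φ x m) := by
  have h : ContDiff ℝ 1 (iteratedFDeriv ℝ i φ) := hφ.iteratedFDeriv_right (by exact_mod_cast le_top)
  exact (ContinuousMultilinearMap.apply ℝ (fun _ : Fin i => Rd d) ℝ m).contDiff.comp h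

theorem iteratedFDeriv_succ_apply_eq_fderiv {d : ℕ} {φ : Rd d → ℝ}
    (hφ : ContDiff ℝ ((⊤ : ℕ∞) : WithTop ℕ∞) φ) (i : ℕ) (m : Fin (i + 1) → Rd d) (x : Rd d) :
    iteratedFDeriv ℝ (i + 1) φ x m =
      fderiv ℝ (fun y => iteratedFDeriv ℝ i φ y (Fin.tail m)) x (m 0) := by
  have h : ContDiff ℝ 1 (iteratedFDeriv ℝ i φ) := hφ.iteratedFDeriv_right (by exact_mod_cast le_top)
  rw [iteratedFDeriv_succ_apply_left]
  have h2 := ((ContinuousMultilinearMap.apply ℝ (fun _ : Fin i => Rd d) ℝ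
    (Fin.tail m)).hasFDerivAt.comp x
    ((h.differentiable one_ne_zero).differentiableAt (x := x)).hasFDerivAt).fderiv
  exact (DFunLike.congr_fun h2 (m 0)).symm

/-- The convolution `(ψ ⋆ φ)(x) = ∫ ψ(t) φ(x - t) dt` of two test functions. -/
noncomputable def convTest {d : ℕ} (ψ φ : TestFn d) : TestFn d where
  toFun := MeasureTheory.convolution ψ φ (ContinuousLinearMap.mul ℝ ℝ) MeasureTheory.volume
  contDiff' := φ.hasCompactSupport.contDiff_convolution_right _ ψ.continuous.locallyIntegrable
    φ.contDiff
  hasCompactSupport' := ψ.hasCompactSupport.convolution _ φ.hasCompactSupport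
  tsupport_subset' := fun _ _ => trivial

theorem convTest_apply {d : ℕ} (ψ φ : TestFn d) (x : Rd d) :
    convTest ψ φ x = ∫ t, ψ t * φ (x - t) := rfl

theorem convTest_comm {d : ℕ} (ψ φ : TestFn d) : convTest ψ φ = convTest φ ψ := by
  ext x
  rw [convTest_apply, convTest_apply, ← MeasureTheory.integral_sub_left_eq_self _ _ x]
  simp [mul_comm]

theorem iteratedFDeriv_convTest {d : ℕ} (ψ φ : TestFn d) (i : ℕ) (m : Fin i → Rd d) (x : Rd d) :
    iteratedFDeriv ℝ i (convTest ψ φ) x m =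
      ∫ t, ψ t * iteratedFDeriv ℝ i φ (x - t) m := by
  induction i generalizing x with
  | zero =>
    simp only [iteratedFDeriv_zero_apply]
    rfl
  | succ i ih =>
    have hg : HasCompactSupport fun y => iteratedFDeriv ℝ i φ y (Fin.tail m) :=
      (φ.hasCompactSupport.iteratedFDeriv i).comp_left 
        (g := fun T : Rd d [×i]→L[ℝ] ℝ => T (Fin.tail m)) rfl
    have hg' := contDiff_iteratedFDeriv_apply φ.contDiff i (Fin.tail m)
    have h := hg.hasFDerivAt_convolution_right (μ := MeasureTheory.volume)
      (ContinuousLinearMap.mul ℝ ℝ) (ψ.continuous.locallyIntegrable) hg' x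
    have hfun : (fun y => iteratedFDeriv ℝ i (convTest ψ φ) y (Fin.tail m)) =
      MeasureTheory.convolution ψ (fun y => iteratedFDeriv ℝ i φ y (Fin.tail m))
        (ContinuousLinearMap.mul ℝ ℝ) MeasureTheory.volume := funext (ih _)
    rw [iteratedFDeriv_succ_apply_eq_fderiv (convTest ψ φ).contDiff, hfun, h.fderiv,
      MeasureTheory.convolution_precompR_apply _ ψ.continuous.locallyIntegrable (hg.fderiv ℝ)
        (hg'.continuous_fderiv one_ne_zero)]
    simp only [iteratedFDeriv_succ_apply_eq_fderiv φ.contDiff]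
    rfl

/-- The Banach space of families, indexed by `i < k`, of bounded continuous functions with values in
the `i`-linear forms. It receives the derivatives of order less than `k` of test functions. It is a
definition rather than an abbreviation so that its topology is the one of its norm. -/
def JetSpace (d k : ℕ) : Type :=
  (i : Fin k) → BoundedContinuousFunction (Rd d) (Rd d [×i]→L[ℝ] ℝ)

noncomputable instance (d k : ℕ) : NormedAddCommGroup (JetSpace d k) :=
  inferInstanceAs (NormedAddCommGroup
    ((i : Fin k) → BoundedContinuousFunction (Rd d) (Rd d [×i]→L[ℝ] ℝ)))

noncomputable instance (d k : ℕ) : NormedSpace ℝ (JetSpace d k) :=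
  inferInstanceAs (NormedSpace ℝ
    ((i : Fin k) → BoundedContinuousFunction (Rd d) (Rd d [×i]→L[ℝ] ℝ)))

instance (d k : ℕ) : CompleteSpace (JetSpace d k) :=
  inferInstanceAs (CompleteSpace
    ((i : Fin k) → BoundedContinuousFunction (Rd d) (Rd d [×i]→L[ℝ] ℝ)))

theorem JetSpace.norm_apply_le {d k : ℕ} (u : JetSpace d k) (i : Fin k) (x : Rd d) :
    ‖u i x‖ ≤ ‖u‖ :=
  ((u i).norm_coe_le_norm x).trans (norm_le_pi_norm
    (G := fun i : Fin k => BoundedContinuousFunction (Rd d) (Rd d [×i]→L[ℝ] ℝ)) u i)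

/-- Evaluation of the component of index `i` at the point `x` and the vectors `m`. -/
noncomputable def JetSpace.eval {d k : ℕ} (i : Fin k) (x : Rd d) (m : Fin i → Rd d) :
    JetSpace d k →L[ℝ] ℝ :=
  LinearMap.mkContinuous
    { toFun := fun u => u i x m
      map_add' := fun _ _ => rfl
      map_smul' := fun _ _ => rfl } (∏ j, ‖m j‖) fun u => by
      rw [mul_comm]
      exact ((u i x).le_opNorm m).trans (by gcongr; exact u.norm_apply_le i x)

theorem JetSpace.dist_le {d k : ℕ} {u v : JetSpace d k} {ε : ℝ} (hε : 0 ≤ ε)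
    (h : ∀ i x, ‖u i x - v i x‖ ≤ ε) : dist u v ≤ ε :=
  (dist_pi_le_iff (X := fun i : Fin k => BoundedContinuousFunction (Rd d) (Rd d [×i]→L[ℝ] ℝ))
    hε).2 fun i => (BoundedContinuousFunction.dist_le hε).2 fun x =>
      (dist_eq_norm (u i x) (v i x)).trans_le (h i x)

/-- The derivatives of order less than `k` of the test functions supported in `K`. -/
noncomputable def jetSupportedIn {d : ℕ} (k : ℕ) (K : TopologicalSpace.Compacts (Rd d)) :
    𝓓_{K}(Rd d, ℝ) →ₗ[ℝ] JetSpace d k where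
  toFun φ i := ContDiffMapSupportedIn.structureMapLM ℝ ⊤ i φ
  map_add' φ ψ := funext fun i => map_add (ContDiffMapSupportedIn.structureMapLM ℝ ⊤ (i : ℕ)) φ ψ
  map_smul' c φ := funext fun i =>
    map_smul (ContDiffMapSupportedIn.structureMapLM ℝ ⊤ (i : ℕ)) c φ

/-- The derivatives of order less than `k` of a test function. -/
noncomputable def jet {d : ℕ} (k : ℕ) (φ : TestFn d) : JetSpace d k :=
  jetSupportedIn k ⟨tsupport φ, φ.hasCompactSupport⟩
    (ContDiffMapSupportedIn.of_support_subset φ.contDiff (subset_tsupport φ))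

theorem jetSupportedIn_apply {d k : ℕ} {K : TopologicalSpace.Compacts (Rd d)} (φ : 𝓓_{K}(Rd d, ℝ))
    (i : Fin k) (x : Rd d) : jetSupportedIn k K φ i x = iteratedFDeriv ℝ i φ x :=
  congrFun (ContDiffMapSupportedIn.structureMapLM_top_apply ℝ (i := (i : ℕ)) φ) x

theorem jet_apply {d k : ℕ} (φ : TestFn d) (i : Fin k) (x : Rd d) :
    jet k φ i x = iteratedFDeriv ℝ i φ x :=
  jetSupportedIn_apply _ i x

theorem JetSpace.ext {d k : ℕ} {u v : JetSpace d k} (h : ∀ i x, u i x = v i x) : u = v :=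
  funext fun i => BoundedContinuousFunction.ext (h i)

theorem jet_translateTest_apply {d k : ℕ} (φ : TestFn d) (t : Rd d) (i : Fin k) (x : Rd d) :
    jet k (translateTest (-t) φ) i x = iteratedFDeriv ℝ i φ (x - t) := by
  rw [jet_apply, sub_eq_add_neg, ← iteratedFDeriv_comp_add_right]
  rfl

theorem continuous_jet_translateTest {d : ℕ} (k : ℕ) (φ : TestFn d) :
    Continuous fun t : Rd d => jet k (translateTest (-t) φ) := by
  have huc : ∀ i : ℕ, UniformContinuous (iteratedFDeriv ℝ i φ) := fun i =>
    (φ.hasCompactSupport.iteratedFDeriv i).uniformContinuous_of_continuous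
      (φ.contDiff.continuous_iteratedFDeriv (by exact_mod_cast le_top))
  rw [continuous_iff_continuousAt]
  intro t
  rw [Metric.continuousAt_iff']
  intro ε hε
  have h : ∀ i : Fin k, ∀ᶠ s in nhds t, ∀ x,
      ‖iteratedFDeriv ℝ i φ (x - s) - iteratedFDeriv ℝ i φ (x - t)‖ ≤ ε / 2 := by
    intro i
    obtain ⟨δ, hδ, h⟩ := Metric.uniformContinuous_iff.1 (huc i) (ε / 2) (half_pos hε)
    filter_upwards [Metric.ball_mem_nhds t hδ] with s hs x
    rw [← dist_eq_norm]
    exact (h (by simpa [dist_eq_norm, norm_sub_rev] using hs)).le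
  filter_upwards [Filter.eventually_all.2 h] with s hs
  refine (JetSpace.dist_le (half_pos hε).le fun i x => ?_).trans_lt (half_lt_self hε)
  rw [jet_translateTest_apply, jet_translateTest_apply]
  exact hs i x

/-- Hahn–Banach theorem: a linear form that is bounded by the norm of a linear map `J` factors through
`J`, continuously. -/
theorem exists_extension_of_bound {D X : Type*} [AddCommGroup D] [Module ℝ D]
    [NormedAddCommGroup X] [NormedSpace ℝ X] (J : D →ₗ[ℝ] X) (g : D →ₗ[ℝ] ℝ) (C : ℝ)
    (hg : ∀ φ, ‖g φ‖ ≤ C * ‖J φ‖) : ∃ F : X →L[ℝ] ℝ, ∀ φ, F (J φ) = g φ := by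
  have hker : LinearMap.ker J ≤ LinearMap.ker g := by
    intro φ hφ
    have h := hg φ
    rw [LinearMap.mem_ker.1 hφ, norm_zero, mul_zero] at h
    exact norm_le_zero_iff.1 h
  obtain ⟨h, hh⟩ : g ∈ LinearMap.range J.dualMap := by
    rw [LinearMap.range_dualMap_eq_dualAnnihilator_ker, Submodule.mem_dualAnnihilator]
    exact fun φ hφ => hker hφ
  have hh' : ∀ φ, h (J φ) = g φ := fun φ => LinearMap.congr_fun hh φ
  let h₀ : LinearMap.range J →L[ℝ] ℝ := (h ∘ₗ (LinearMap.range J).subtype).mkContinuous C (by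
    rintro ⟨_, φ, rfl⟩
    change ‖h (J φ)‖ ≤ C * ‖J φ‖
    rw [hh']
    exact hg φ)
  obtain ⟨F, hF, -⟩ := exists_extension_norm_eq (LinearMap.range J) h₀
  exact ⟨F, fun φ => (hF ⟨J φ, φ, rfl⟩).trans (hh' φ)⟩

/-- On the test functions supported in a fixed compact set, a distribution is a continuous linear
form in finitely many derivatives. -/
theorem exists_eq_jet {d : ℕ} (f : Distr d) (K : TopologicalSpace.Compacts (Rd d)) :
    ∃ (k : ℕ) (F : JetSpace d k →L[ℝ] ℝ),
      ∀ φ : TestFn d, Function.support φ ⊆ K → f φ = F (jet k φ) := by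
  let ι : 𝓓_{K}(Rd d, ℝ) →L[ℝ] TestFn d := TestFunction.ofSupportedInCLM ℝ (fun _ _ => trivial)
  let g : 𝓓_{K}(Rd d, ℝ) →ₗ[ℝ] ℝ := (f : TestFn d →ₗ[ℝ] ℝ) ∘ₗ (ι : 𝓓_{K}(Rd d, ℝ) →ₗ[ℝ] TestFn d)
  have hgc : Continuous g := (map_continuous f).comp ι.continuous
  obtain ⟨s, C, -, hC⟩ := Seminorm.bound_of_continuous
    (ContDiffMapSupportedIn.withSeminorms ℝ (Rd d) ℝ ⊤ K)
    ((normSeminorm ℝ ℝ).comp g) (continuous_norm.comp hgc)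
  obtain ⟨k, hk⟩ : ∃ k, s ⊆ Finset.range k := s.exists_nat_subset_range
  have hbound : ∀ φ, ‖g φ‖ ≤ C * ‖jetSupportedIn k K φ‖ := by
    intro φ
    have h : (s.sup (ContDiffMapSupportedIn.seminorm ℝ (Rd d) ℝ ⊤ K)) φ ≤
        ‖jetSupportedIn k K φ‖ :=
      Seminorm.finset_sup_apply_le (norm_nonneg _) fun i hi =>
        (ContDiffMapSupportedIn.seminorm_top_le_iff ℝ (norm_nonneg _) i φ).2 fun x _ =>
          (congrArg norm (jetSupportedIn_apply φ ⟨i, Finset.mem_range.1 (hk hi)⟩ x)).symm.trans_le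
            (JetSpace.norm_apply_le _ _ x)
    exact (hC φ).trans (mul_le_mul_of_nonneg_left h C.2)
  obtain ⟨F, hF⟩ := exists_extension_of_bound (jetSupportedIn k K) g C hbound
  refine ⟨k, F, fun φ hφ => ?_⟩
  let φ' : 𝓓_{K}(Rd d, ℝ) := ContDiffMapSupportedIn.of_support_subset φ.contDiff hφ
  have h1 : jetSupportedIn k K φ' = jet k φ :=
    JetSpace.ext fun i x => by rw [jet_apply, jetSupportedIn_apply]; rfl
  rw [← h1, hF]
  rfl

open scoped Pointwise in
theorem support_translateTest_subset {d : ℕ} (φ : TestFn d) {A : Set (Rd d)} {t : Rd d}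
    (ht : t ∈ A) : Function.support (translateTest (-t) φ) ⊆ A + tsupport φ := by
  intro x hx
  refine ⟨t, ht, x - t, subset_tsupport _ ?_, add_sub_cancel _ _⟩
  rwa [Function.mem_support, translateTest_apply, ← sub_eq_add_neg] at hx

open scoped Pointwise in
theorem continuous_apply_translateTest {d : ℕ} (f : Distr d) (φ : TestFn d) :
    Continuous fun t : Rd d => f (translateTest (-t) φ) := by
  rw [continuous_iff_continuousAt]
  intro t
  obtain ⟨k, F, hF⟩ := exists_eq_jet f
    ⟨Metric.closedBall t 1 + tsupport φ, (isCompact_closedBall t 1).add φ.hasCompactSupport⟩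
  refine ((F.continuous.comp (continuous_jet_translateTest k φ)).continuousAt).congr ?_
  filter_upwards [Metric.closedBall_mem_nhds t one_pos] with s hs
  exact (hF _ (support_translateTest_subset φ hs)).symm

open scoped Pointwise in
/-- A distribution commutes with the integral that defines a convolution. -/
theorem apply_convTest {d : ℕ} (f : Distr d) (ψ φ : TestFn d) :
    f (convTest ψ φ) = ∫ t, ψ t * f (translateTest (-t) φ) := by
  obtain ⟨k, F, hF⟩ := exists_eq_jet f
    ⟨tsupport ψ + tsupport φ, ψ.hasCompactSupport.isCompact.add φ.hasCompactSupport⟩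
  let J : Rd d → JetSpace d k := fun t => jet k (translateTest (-t) φ)
  have hcont : Continuous fun t => ψ t • J t := ψ.continuous.smul (continuous_jet_translateTest k φ)
  have hint : MeasureTheory.Integrable fun t => ψ t • J t :=
    hcont.integrable_of_hasCompactSupport (ψ.hasCompactSupport.smul_right (f' := J))
  have h1 : ∀ t, ψ t * f (translateTest (-t) φ) = F (ψ t • J t) := by
    intro t
    rw [map_smul, smul_eq_mul]
    by_cases ht : ψ t = 0
    · rw [ht, zero_mul, zero_mul]
    · rw [hF _ (support_translateTest_subset φ (subset_tsupport _ ht))]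
  have h2 : jet k (convTest ψ φ) = ∫ t, ψ t • J t := by
    refine JetSpace.ext fun i x => ContinuousMultilinearMap.ext fun m => ?_
    refine Eq.trans ?_ ((JetSpace.eval i x m).integral_comp_comm hint)
    rw [jet_apply, iteratedFDeriv_convTest]
    congr 1
    funext t
    rw [← jet_translateTest_apply]
    rfl
  have hsupp : Function.support (convTest ψ φ) ⊆ tsupport ψ + tsupport φ := by
    intro x hx
    by_contra hx'
    refine hx ?_
    rw [convTest_apply]
    refine MeasureTheory.integral_eq_zero_of_ae (Filter.Eventually.of_forall fun t => ?_)
    by_contra ht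
    have ht' := mul_ne_zero_iff.1 ht
    exact hx' ⟨t, subset_tsupport _ ht'.1, x - t, subset_tsupport _ ht'.2, add_sub_cancel _ _⟩
  simp_rw [h1]
  rw [F.integral_comp_comm hint, hF _ hsupp, h2]

/-! ### Invariant spaces -/

/-- The representation of an additive group `E` on an invariant subspace `V`, for an action `τ` of
`E` by linear operators. -/
noncomputable def restrictRep {E X : Type*} [AddCommGroup E] [AddCommGroup X] [Module ℝ X]
    (τ : E → X →ₗ[ℝ] X) (h0 : ∀ f, τ 0 f = f) (hadd : ∀ x y f, τ (x + y) f = τ x (τ y f))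
    (V : Submodule ℝ X) (hV : ∀ x, ∀ f ∈ V, τ x f ∈ V) :
    Multiplicative E →* Module.End ℝ V where
  toFun x := (τ x.toAdd).restrict (hV x.toAdd)
  map_one' := LinearMap.ext fun f => Subtype.ext (h0 f)
  map_mul' x y := LinearMap.ext fun f => Subtype.ext (hadd x.toAdd y.toAdd f)

open scoped Pointwise in
theorem orbitDifference_eq_sub {d : ℕ} (G : Subgroup (Matrix.GeneralLinearGroup (Fin d) ℝ))
    (z₀ : Rd d) :
    orbitDifference G z₀ = (fun P : Matrix.GeneralLinearGroup (Fin d) ℝ => P.1.mulVec z₀) '' (G : Set _) -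
      (fun P : Matrix.GeneralLinearGroup (Fin d) ℝ => P.1.mulVec z₀) '' (G : Set _) := by
  ext w
  simp only [orbitDifference, Set.mem_sub, Set.mem_image, exists_exists_and_eq_and]
  exact ⟨fun ⟨P, hP, Q, hQ, h⟩ => ⟨P, hP, Q, hQ, h.symm⟩,
    fun ⟨P, hP, Q, hQ, h⟩ => ⟨P, hP, Q, hQ, h.symm⟩⟩

/-- The relation `τ_h O_P = O_P τ_{P h}` makes `τ_{P z₀}` conjugate to `τ_{z₀}`, so that these
operators have the same characteristic polynomial and `isNilpotent_sub_one` applies. -/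
theorem isNilpotent_restrictRep_sub_one {d : ℕ} {X : Type*} [AddCommGroup X] [Module ℝ X]
    (τ : Rd d → X →ₗ[ℝ] X) (h0 : ∀ f, τ 0 f = f) (hadd : ∀ x y f, τ (x + y) f = τ x (τ y f))
    (V : Submodule ℝ X) [FiniteDimensional ℝ V] (hV : ∀ x, ∀ f ∈ V, τ x f ∈ V)
    {G : Subgroup (Matrix.GeneralLinearGroup (Fin d) ℝ)} {z₀ : Rd d}
    (hz₀ : (interior (orbitDifference G z₀)).Nonempty)
    (O : Matrix.GeneralLinearGroup (Fin d) ℝ → X →ₗ[ℝ] X)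
    (hO : ∀ P, Function.Injective (O P))
    (hτO : ∀ P h f, τ h (O P f) = O P (τ (P.1.mulVec h) f))
    (hVO : ∀ P ∈ G, ∀ f ∈ V, O P f ∈ V) (x : Rd d) :
    IsNilpotent (restrictRep τ h0 hadd V hV (.ofAdd x) - 1) := by
  rw [orbitDifference_eq_sub] at hz₀
  refine isNilpotent_sub_one _ (χ := LinearMap.charpoly (restrictRep τ h0 hadd V hV (.ofAdd z₀)))
    ?_ hz₀ x
  rintro _ ⟨P, hP, rfl⟩
  have hinj : Function.Injective ((O P).restrict (hVO P hP)) := fun f g h =>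
    Subtype.ext (hO P (congrArg Subtype.val h))
  let e : V ≃ₗ[ℝ] V := LinearEquiv.ofInjectiveEndo _ hinj
  rw [← e.charpoly_conj]
  congr 1
  refine LinearMap.ext fun f => ?_
  obtain ⟨g, rfl⟩ := e.surjective f
  rw [LinearEquiv.conj_apply_apply, e.symm_apply_apply]
  exact Subtype.ext (hτO P z₀ g).symm

theorem continuous_dual_apply_of_separating {V T : Type*} [AddCommGroup V] [Module ℝ V]
    [FiniteDimensional ℝ V] [TopologicalSpace T] {u : T → V} {s : Set (Module.Dual ℝ V)}
    (hs : ∀ v ≠ 0, ∃ l ∈ s, l v ≠ 0) (hu : ∀ l ∈ s, Continuous fun t => l (u t))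
    (l : Module.Dual ℝ V) : Continuous fun t => l (u t) := by
  have hl : l ∈ Submodule.span ℝ s := by
    rw [Submodule.span_eq_top_of_ne_zero hs]; trivial
  induction hl using Submodule.span_induction with
  | mem l hl => exact hu l hl
  | zero => exact continuous_const
  | add l₁ l₂ _ _ h₁ h₂ => exact h₁.add h₂
  | smul c l _ h => exact h.const_smul c

/-! ### Continuous functions -/

theorem substFun_injective {d : ℕ} (P : Matrix.GeneralLinearGroup (Fin d) ℝ) :
    Function.Injective (substFun P) := by
  intro f g h
  ext x
  have := DFunLike.congr_fun h (P⁻¹.1.mulVec x)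
  change f (P.1.mulVec (P⁻¹.1.mulVec x)) = g (P.1.mulVec (P⁻¹.1.mulVec x)) at this
  simpa [Matrix.mulVec_mulVec, ← Units.val_mul] using this

theorem isPolynomialFun_of_mem {d : ℕ} {G : Subgroup (Matrix.GeneralLinearGroup (Fin d) ℝ)}
    {z₀ : Rd d} (hz₀ : (interior (orbitDifference G z₀)).Nonempty)
    (V : Submodule ℝ C(Rd d, ℝ)) [FiniteDimensional ℝ V]
    (hV : ∀ h : Rd d, ∀ f ∈ V, translateFun h f ∈ V)
    (hVO : ∀ P ∈ G, ∀ f ∈ V, substFun P f ∈ V) {f : C(Rd d, ℝ)} (hf : f ∈ V) :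
    IsPolynomialFun f := by
  have h0 : ∀ f : C(Rd d, ℝ), translateFun 0 f = f := fun f =>
    ContinuousMap.ext fun x => congrArg f (add_zero x)
  have hadd : ∀ (x y : Rd d) (f : C(Rd d, ℝ)),
      translateFun (x + y) f = translateFun x (translateFun y f) := fun x y f =>
    ContinuousMap.ext fun z => congrArg f (add_assoc z x y).symm
  let ρ := restrictRep translateFun h0 hadd V hV
  have hρ := isNilpotent_restrictRep_sub_one translateFun h0 hadd V hV hz₀ substFun
    substFun_injective
    (fun P h f => ContinuousMap.ext fun x => congrArg f (Matrix.mulVec_add P.1 x h)) hVO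
  let ev : Rd d → Module.Dual ℝ V := fun y =>
    { toFun := fun f => f.1 y
      map_add' := fun _ _ => rfl
      map_smul' := fun _ _ => rfl }
  have hc : ∀ (l : Module.Dual ℝ V) (v : V), Continuous fun x : Rd d => l (ρ (.ofAdd x) v) := by
    intro l v
    refine continuous_dual_apply_of_separating (s := Set.range ev) ?_ ?_ l
    · intro v hv
      by_contra! h
      exact hv (Subtype.ext (ContinuousMap.ext fun y => h _ ⟨y, rfl⟩))
    · rintro _ ⟨y, rfl⟩
      exact v.1.continuous.comp (continuous_const.add continuous_id)
  obtain ⟨p, hp⟩ := exists_mvPolynomial_of_unipotent ρ hρ hc (ev 0) ⟨f, hf⟩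
  exact ⟨p, fun x => (congrArg f (zero_add x)).symm.trans (hp x)⟩

/-! ### Distributions -/

theorem substTest_inv_substTest {d : ℕ} (P : Matrix.GeneralLinearGroup (Fin d) ℝ) (φ : TestFn d) :
    substTest P⁻¹ (substTest P φ) = φ := by
  ext x
  rw [substTest_apply, substTest_apply, Matrix.mulVec_mulVec, ← Units.val_mul, mul_inv_cancel,
    Units.val_one, Matrix.one_mulVec]

theorem substDistr_injective {d : ℕ} (P : Matrix.GeneralLinearGroup (Fin d) ℝ) :
    Function.Injective (substDistr P) := by
  intro f g h
  ext φ
  have h1 : substDistr P f (substTest P φ) = substDistr P g (substTest P φ) := by rw [h]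
  rw [substDistr_apply, substDistr_apply, substTest_inv_substTest] at h1
  have hdet : P.1.det ≠ 0 := ((Matrix.isUnit_iff_isUnit_det _).1 P.isUnit).ne_zero
  exact mul_left_cancel₀ (inv_ne_zero (abs_ne_zero.2 hdet)) h1

theorem translateDistr_substDistr {d : ℕ} (P : Matrix.GeneralLinearGroup (Fin d) ℝ) (h : Rd d)
    (f : Distr d) :
    translateDistr h (substDistr P f) = substDistr P (translateDistr (P.1.mulVec h) f) := by
  ext φ
  rw [translateDistr_apply, substDistr_apply, substDistr_apply, translateDistr_apply]
  congr 2
  ext x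
  rw [substTest_apply, translateTest_apply, translateTest_apply, substTest_apply,
    Matrix.mulVec_add, Matrix.mulVec_neg, Matrix.mulVec_mulVec, ← Units.val_mul, inv_mul_cancel,
    Units.val_one, Matrix.one_mulVec]

theorem translateTest_zero {d : ℕ} (φ : TestFn d) : translateTest 0 φ = φ := by
  ext x
  rw [translateTest_apply, add_zero]

theorem translateTest_add {d : ℕ} (x y : Rd d) (φ : TestFn d) :
    translateTest (x + y) φ = translateTest y (translateTest x φ) := by
  ext z
  rw [translateTest_apply, translateTest_apply, translateTest_apply, add_assoc, add_comm x]

theorem integrable_eval_mul {d : ℕ} (p : MvPolynomial (Fin d) ℝ) (φ : TestFn d) :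
    MeasureTheory.Integrable fun x => MvPolynomial.eval x p * φ x :=
  ((MvPolynomial.continuous_eval p).mul φ.continuous).integrable_of_hasCompactSupport
    φ.hasCompactSupport.mul_left

/-- Integration of test functions against a polynomial. -/
noncomputable def integralAgainst {d : ℕ} (p : MvPolynomial (Fin d) ℝ) : TestFn d →ₗ[ℝ] ℝ where
  toFun φ := ∫ x, MvPolynomial.eval x p * φ x
  map_add' φ ψ := by
    rw [← MeasureTheory.integral_add (integrable_eval_mul p φ) (integrable_eval_mul p ψ)]
    congr 1
    funext x
    exact mul_add _ _ _
  map_smul' c φ := by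
    rw [RingHom.id_apply, smul_eq_mul, ← MeasureTheory.integral_const_mul]
    congr 1
    funext x
    exact mul_left_comm _ _ _

/-- If every function `h ↦ f(τ_{-h} φ)` is a combination of finitely many polynomials that do not
depend on `φ`, then `f` is given by a polynomial. -/
theorem isPolynomialDistr_of_translate_eq {d : ℕ} {ι : Type*} [Fintype ι] (f : Distr d)
    (p : ι → MvPolynomial (Fin d) ℝ) (c : TestFn d → ι → ℝ)
    (h : ∀ (φ : TestFn d) (x : Rd d),
      f (translateTest (-x) φ) = ∑ j, c φ j * MvPolynomial.eval x (p j)) :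
    IsPolynomialDistr f := by
  have hconv : ∀ φ ψ : TestFn d, f (convTest ψ φ) = ∑ j, c φ j * integralAgainst (p j) ψ := by
    intro φ ψ
    rw [apply_convTest]
    simp_rw [h, Finset.mul_sum]
    rw [MeasureTheory.integral_finsetSum]
    · refine Finset.sum_congr rfl fun j _ => ?_
      rw [integralAgainst, LinearMap.coe_mk, AddHom.coe_mk, ← MeasureTheory.integral_const_mul]
      congr 1
      funext t
      ring
    · intro j _
      refine ((integrable_eval_mul (p j) ψ).const_mul (c φ j)).congr (.of_forall fun t => ?_)
      simp only []
      ring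
  have hker : ⨅ j, LinearMap.ker (integralAgainst (p j)) ≤ LinearMap.ker (f : TestFn d →ₗ[ℝ] ℝ) := by
    intro φ hφ
    have hφ' : ∀ j, integralAgainst (p j) φ = 0 := fun j => (Submodule.mem_iInf _).1 hφ j
    -- `h ↦ f(τ_{-h} φ)` integrates to `f(ψ ⋆ φ) = f(φ ⋆ ψ) = 0` against every test function `ψ`.
    have hae := ae_eq_zero_of_integral_contDiff_smul_eq_zero (μ := MeasureTheory.volume)
      (continuous_apply_translateTest f φ).locallyIntegrable fun g hg hgc => by
        let ψ : TestFn d := ⟨g, hg, hgc, fun _ _ => trivial⟩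
        have h1 : f (convTest ψ φ) = 0 := by
          rw [convTest_comm, hconv]
          simp [hφ']
        rwa [apply_convTest] at h1
    have hzero := MeasureTheory.Measure.eq_of_ae_eq (μ := MeasureTheory.volume)
      (g := fun _ => (0 : ℝ)) hae (continuous_apply_translateTest f φ) continuous_const
    have h2 := congrFun hzero 0
    simp only [neg_zero, translateTest_zero] at h2
    exact h2
  obtain ⟨a, ha⟩ := (Submodule.mem_span_range_iff_exists_fun ℝ).1 (mem_span_of_iInf_ker_le_ker hker)
  refine ⟨∑ j, MvPolynomial.C (a j) * p j, fun φ => ?_⟩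
  have h1 : f φ = ∑ j, a j * integralAgainst (p j) φ := by
    have := LinearMap.congr_fun ha φ
    rw [LinearMap.sum_apply] at this
    exact this.symm
  rw [h1]
  simp only [map_sum, map_mul, MvPolynomial.eval_C, Finset.sum_mul, mul_assoc]
  rw [MeasureTheory.integral_finsetSum _ fun j _ => (integrable_eval_mul (p j) φ).const_mul (a j)]
  refine Finset.sum_congr rfl fun j _ => ?_
  rw [MeasureTheory.integral_const_mul]
  rfl

theorem isPolynomialDistr_of_mem {d : ℕ} {G : Subgroup (Matrix.GeneralLinearGroup (Fin d) ℝ)}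
    {z₀ : Rd d} (hz₀ : (interior (orbitDifference G z₀)).Nonempty)
    (V : Submodule ℝ (Distr d)) [FiniteDimensional ℝ V]
    (hV : ∀ h : Rd d, ∀ f ∈ V, translateDistr h f ∈ V)
    (hVO : ∀ P ∈ G, ∀ f ∈ V, substDistr P f ∈ V) {f : Distr d} (hf : f ∈ V) :
    IsPolynomialDistr f := by
  let τ : Rd d → Distr d →ₗ[ℝ] Distr d := fun h => (translateDistr h : Distr d →ₗ[ℝ] Distr d)
  have h0 : ∀ f, τ 0 f = f := fun f => by
    ext φ
    exact congrArg f ((congrArg (translateTest · φ) neg_zero).trans (translateTest_zero φ))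
  have hadd : ∀ x y f, τ (x + y) f = τ x (τ y f) := fun x y f => by
    ext φ
    exact congrArg f ((congrArg (translateTest · φ) (neg_add x y)).trans
      (translateTest_add (-x) (-y) φ))
  let ρ := restrictRep τ h0 hadd V hV
  have hρ := isNilpotent_restrictRep_sub_one τ h0 hadd V hV hz₀
    (fun P => (substDistr P : Distr d →ₗ[ℝ] Distr d)) substDistr_injective
    translateDistr_substDistr hVO
  let ev : TestFn d → Module.Dual ℝ V := fun φ =>
    { toFun := fun f => f.1 φ
      map_add' := fun _ _ => rfl
      map_smul' := fun _ _ => rfl }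
  have hc : ∀ (l : Module.Dual ℝ V) (v : V), Continuous fun x : Rd d => l (ρ (.ofAdd x) v) := by
    intro l v
    refine continuous_dual_apply_of_separating (s := Set.range ev) ?_ ?_ l
    · intro v hv
      by_contra! h
      exact hv (Subtype.ext (by ext φ; exact h _ ⟨φ, rfl⟩))
    · rintro _ ⟨φ, rfl⟩
      exact continuous_apply_translateTest v.1 φ
  let b := Module.finBasis ℝ (Module.Dual ℝ V)
  choose p hp using fun j => exists_mvPolynomial_of_unipotent ρ hρ hc (b j) ⟨f, hf⟩
  refine isPolynomialDistr_of_translate_eq f p (fun φ => b.repr (ev φ)) fun φ x => ?_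
  have h1 : f (translateTest (-x) φ) = ev φ (ρ (.ofAdd x) ⟨f, hf⟩) := rfl
  rw [h1]
  conv_lhs => rw [← b.sum_repr (ev φ)]
  rw [LinearMap.sum_apply]
  refine Finset.sum_congr rfl fun j _ => ?_
  rw [← hp]
  rfl

end InvariantPolynomials

theorem theorem2p1 (d : ℕ) (G : Subgroup (Matrix.GeneralLinearGroup (Fin d) ℝ))
    (hG : ∃ z₀ : InvariantPolynomials.Rd d,
      (interior (InvariantPolynomials.orbitDifference G z₀)).Nonempty) :
    (∀ V : Submodule ℝ C(InvariantPolynomials.Rd d, ℝ), FiniteDimensional ℝ V →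
      (∀ h : InvariantPolynomials.Rd d, ∀ f ∈ V, InvariantPolynomials.translateFun h f ∈ V) →
      (∀ P ∈ G, ∀ f ∈ V, InvariantPolynomials.substFun P f ∈ V) →
      ∀ f ∈ V, InvariantPolynomials.IsPolynomialFun f) ∧
    (∀ V : Submodule ℝ (InvariantPolynomials.Distr d), FiniteDimensional ℝ V →
      (∀ h : InvariantPolynomials.Rd d, ∀ f ∈ V, InvariantPolynomials.translateDistr h f ∈ V) →
      (∀ P ∈ G, ∀ f ∈ V, InvariantPolynomials.substDistr P f ∈ V) →
      ∀ f ∈ V, InvariantPolynomials.IsPolynomialDistr f) := by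
  obtain ⟨z₀, hz₀⟩ := hG
  exact ⟨fun V _ hV hVO _ hf => InvariantPolynomials.isPolynomialFun_of_mem hz₀ V hV hVO hf,
    fun V _ hV hVO _ hf => InvariantPolynomials.isPolynomialDistr_of_mem hz₀ V hV hVO hf⟩
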